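/- **Proposition 4.** Fix a set $B$ of bodies with subsets $IOb$ (inertial observers) and $Ph$ (light signals), an ordered field $Q$, and a relation $W(o,b,\bar x)$ for $o,b\in B$, $\bar x\in Q^4$ ("observer $o$ coordinatizes body $b$ at $\bar x$"), where $x_1,x_2,x_3$ are the space coordinates and $x_4$ is the time coordinate of $\bar x$. Put $ev_o(\bar x)=\{b: W(o,b,\bar x)\}$, $wline_o(b)=\{\bar x: W(o,b,\bar x)\}$, $dist(\bar x,\bar y)=\sqrt{(x_1-y_1)^2+(x_2-y_2)^2+(x_3-y_3)^2}$, $time(\bar x,\bar y)=|x_4-y_4|$, and write $w_{oo'}(\bar x)=\bar x'$ iff $ev_o(\bar x)=ev_{o'}(\bar x')$. If $wline_i(b)$ is contained in a line, write $v_i(b)=v$ iff there are distinct $\bar x,\bar y\in wline_i(b)$ with $dist(\bar x,\bar y)=v\cdot time(\bar x,\bar y)$. Assume $SpecRel_0$, that is: * $AxEField$: $Q$ is a Euclidean field (an ordered field in which every positive element is a square); * $AxPh$: for every $i\in IOb$ there is $c_i\in Q$, $c_i>0$, such that for all $\bar x,\bar y\in Q^4$: there is $p\in Ph$ with $\bar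 x,\bar y\in wline_i(p)$ if and only if $dist(\bar x,\bar y)=c_i\cdot time(\bar x,\bar y)$; * $AxEv$: for all $i,i'\in IOb$ and $\bar x\in Q^4$ there is $\bar x'\in Q^4$ with $ev_i(\bar x)=ev_{i'}(\bar x')$; * $AxSelf$: for all $i\in IOb$ and $\bar x\in Q^4$: $\bar x\in wline_i(i)$ if and only if $x_1=x_2=x_3=0$. Assume moreover $Ax(c_i=c_j)$: $v_i(p)=v_j(p)$ for all $i,j\in IOb$ and $p\in Ph$ (if either side is defined, so is the other and they are equal). Then the following are equivalent: * $AxSymTime$: for all $i,i'\in IOb$ and $t\in Q$, $time\big(w_{ii'}(t\cdot\bar 1_t),w_{ii'}(\bar o)\big)=time\big(w_{i'i}(t\cdot\bar 1_t),w_{i'i}(\bar o)\big)$, where $\bar o=(0,0,0,0)$ and $\bar 1_t=(0,0,0,1)$; * $AxSymDist$: for all $i,i'\in IOb$ and $\bar x,\bar y,\bar x',\bar y'\in Q^4$ with $ev_i(\bar x)=ev_{i'}(\bar x')$, $ev_i(\bar y)=ev_{i'}(\bar y')$, $time(\bar x,\bar y)=0$ and $time(\bar x',\bar y')=0$, one has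 $dist(\bar x,\bar y)=dist(\bar x',\bar y')$. (Under $SpecRel_0$ the relations $w_{ii'}$, $i,i'\in IOb$, are functions on $Q^4$.) -/

import Mathlib

namespace SpecRel

/-- Every positive quantity has a square root. For an ordered field `Q` this says that
`Q` is a Euclidean field. -/
def AxEField (Q : Type*) [Field Q] [LinearOrder Q] : Prop :=
  ∀ x : Q, 0 < x → ∃ y : Q, x = y ^ 2

open Classical in
/-- The nonnegative square root in an ordered field (`0` if there is none). -/
noncomputable def sqrt {Q : Type*} [Field Q] [LinearOrder Q] (a : Q) : Q :=
  if h : ∃ y : Q, 0 ≤ y ∧ y ^ 2 = a then h.choose else 0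

/-- In a Euclidean field `sqrt a` is the nonnegative square root of any `a ≥ 0`. -/
theorem sqrt_spec {Q : Type*} [Field Q] [LinearOrder Q] [IsStrictOrderedRing Q]
    (hQ : AxEField Q) {a : Q} (ha : 0 ≤ a) : 0 ≤ sqrt a ∧ sqrt a ^ 2 = a := by
  have h : ∃ y : Q, 0 ≤ y ∧ y ^ 2 = a := by
    rcases ha.eq_or_lt with rfl | ha
    · exact ⟨0, le_rfl, by simp⟩
    · obtain ⟨y, hy⟩ := hQ a ha
      exact ⟨|y|, abs_nonneg y, by rw [sq_abs, hy]⟩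
  unfold sqrt
  rw [dif_pos h]
  exact h.choose_spec

/-- Coordinate points `(x, y, z, t)`: indices `0, 1, 2` are the space coordinates,
index `3` is the time coordinate. -/
abbrev Coord (Q : Type*) : Type _ := Fin 4 → Q

section Coordinates

variable {Q : Type*} [Field Q] [LinearOrder Q]

/-- Spatial distance of two coordinate points. -/
noncomputable def dist (x y : Coord Q) : Q :=
  sqrt ((x 0 - y 0) ^ 2 + (x 1 - y 1) ^ 2 + (x 2 - y 2) ^ 2)

/-- Time difference of two coordinate points. -/
def time (x y : Coord Q) : Q := |x 3 - y 3|

/-- The unit vector `(0, 0, 0, 1)` of the time axis. -/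
def oneT : Coord Q := ![0, 0, 0, 1]

end Coordinates

/-- The basic (non-logical) concepts over bodies `B` and quantities `Q`: inertial observers,
light signals, and the worldview relation `W o b x`, "observer `o` coordinatizes body `b`
at the coordinate point `x`". -/
structure Frame (B Q : Type*) where
  IOb : Set B
  Ph : Set B
  W : B → B → Coord Q → Prop

namespace Frame

variable {B Q : Type*} (M : Frame B Q)

/-- The event coordinatized by `o` at `x`. -/
def ev (o : B) (x : Coord Q) : Set B := {b | M.W o b x}

/-- The worldline of `b` according to `o`. -/
def wline (o b : B) : Set (Coord Q) := {x | M.W o b x}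

/-- The worldview transformation `w_{oo'}` as a binary relation: `M.wvt o o' x x'` means
`w_{oo'}(x) = x'`. -/
def wvt (o o' : B) (x x' : Coord Q) : Prop := M.ev o x = M.ev o' x'

/-- Inertial observers coordinatize the same events. -/
def AxEv : Prop :=
  ∀ i ∈ M.IOb, ∀ i' ∈ M.IOb, ∀ x : Coord Q, ∃ x' : Coord Q, M.ev i x = M.ev i' x'

variable [Field Q] [LinearOrder Q]

/-- Inertial observers are stationary in the origin of their own coordinate systems. -/
def AxSelf : Prop :=
  ∀ i ∈ M.IOb, ∀ x : Coord Q, x ∈ M.wline i i ↔ x 0 = 0 ∧ x 1 = 0 ∧ x 2 = 0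

/-- For every inertial observer there is a (positive, finite) speed `c` such that two
coordinate points lie on the worldline of a light signal iff they are related by speed `c`. -/
def AxPh : Prop :=
  ∀ i ∈ M.IOb, ∃ c : Q, 0 < c ∧ ∀ x y : Coord Q,
    (∃ p ∈ M.Ph, x ∈ M.wline i p ∧ y ∈ M.wline i p) ↔ dist x y = c * time x y

/-- `M.HasSpeed i b v` means `v_i(b) = v`: the worldline of `b` according to `i` lies on a
line, and some (hence any) two distinct points of it are related by speed `v`. -/
def HasSpeed (i b : B) (v : Q) : Prop :=
  Collinear Q (M.wline i b) ∧
    ∃ x ∈ M.wline i b, ∃ y ∈ M.wline i b, x ≠ y ∧ dist x y = v * time x y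

/-- The speed of every light signal is the same for all inertial observers. The equation
`v_i(p) = v_j(p)` is between partially defined terms: one side is defined iff the other is,
and then the values agree. -/
def AxSameC : Prop :=
  ∀ i ∈ M.IOb, ∀ j ∈ M.IOb, ∀ p ∈ M.Ph, ∀ v : Q, M.HasSpeed i p v ↔ M.HasSpeed j p v

/-- The axiom system `SpecRel₀` (`Q` being an ordered field is given by the instances). -/
structure SpecRel0 : Prop where
  axPh : M.AxPh
  axEField : AxEField Q
  axEv : M.AxEv
  axSelf : M.AxSelf

/-- Inertial observers agree on the spatial distance of events that are simultaneous
for both of them. -/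
def AxSymDist : Prop :=
  ∀ i ∈ M.IOb, ∀ i' ∈ M.IOb, ∀ x y x' y' : Coord Q,
    M.ev i x = M.ev i' x' → M.ev i y = M.ev i' y' →
    time x y = 0 → time x' y' = 0 → dist x y = dist x' y'

/-- Any two inertial observers see each other's clocks slowed down with the same rate:
`time (w_{ii'}(t·1ₜ), w_{ii'}(0)) = time (w_{i'i}(t·1ₜ), w_{i'i}(0))`. -/
def AxSymTime : Prop :=
  ∀ i ∈ M.IOb, ∀ i' ∈ M.IOb, ∀ t : Q, ∀ a b a' b' : Coord Q,
    M.wvt i i' (t • oneT) a → M.wvt i i' 0 b →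
    M.wvt i' i (t • oneT) a' → M.wvt i' i 0 b' →
    time a b = time a' b'

end Frame

end SpecRel

namespace SpecRel

/-! By `AxSameC` all inertial observers share one light speed `c`, and after rescaling time so that
`c` becomes `1`, a worldview transformation is a bijection preserving the null relation both ways.
The Alexandrov–Zeeman theorem (`NullPreserving.exists_ringHom`) then says that it transforms the
Minkowski form by `κ * ψ`, with `κ > 0` and `ψ` a field endomorphism. Over a general Euclidean field
`ψ` need not be the identity, so a symmetry axiom has to eliminate both `κ` and `ψ`.

Each of `AxSymTime` and `AxSymDist` is shown to be equivalent to exact preservation of the form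
(`PreservesForm`). `AxSymDist` compares vectors spatial for both observers and gives `r = κ * ψ r`
for all `r > 0`. `AxSymTime` compares both directions of the transformation and makes `ψ` a monotone
involution on positive elements. Conversely, simultaneous distances and mutual clock rates are both
values of the form.

Zeeman's theorem is proved through hyperplanes orthogonal to null vectors: these are definable from
the null relation, which yields additivity (`image_add`) and then a common scaling map on null
directions, which is `ψ`. -/

theorem ext_space_time {Q : Type*} {x y : Coord Q} (h0 : x 0 = y 0) (h1 : x 1 = y 1) (h2 : x 2 = y 2)
    (h3 : x 3 = y 3) : x = y := by
  ext i; fin_cases i <;> assumption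

/-! ### The Minkowski form and the null relation. -/

section Minkowski

variable {Q : Type*} [Field Q]

/-- The Minkowski form of signature `(+, +, +, -)`. -/
def mink (x y : Coord Q) : Q := x 0 * y 0 + x 1 * y 1 + x 2 * y 2 - x 3 * y 3

theorem mink_comm (x y : Coord Q) : mink x y = mink y x := by
  simp only [mink]; ring

theorem mink_add_left (x y z : Coord Q) : mink (x + y) z = mink x z + mink y z := by
  simp only [mink, Pi.add_apply]; ring

theorem mink_sub_left (x y z : Coord Q) : mink (x - y) z = mink x z - mink y z := by
  simp only [mink, Pi.sub_apply]; ring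

theorem mink_smul_left (s : Q) (x z : Coord Q) : mink (s • x) z = s * mink x z := by
  simp only [mink, Pi.smul_apply, smul_eq_mul]; ring

theorem mink_add_right (x y z : Coord Q) : mink z (x + y) = mink z x + mink z y := by
  simp only [mink, Pi.add_apply]; ring

theorem mink_sub_right (x y z : Coord Q) : mink z (x - y) = mink z x - mink z y := by
  simp only [mink, Pi.sub_apply]; ring

theorem mink_smul_right (s : Q) (x z : Coord Q) : mink z (s • x) = s * mink z x := by
  simp only [mink, Pi.smul_apply, smul_eq_mul]; ring

@[simp] theorem mink_zero_left (x : Coord Q) : mink 0 x = 0 := by simp [mink]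

@[simp] theorem mink_zero_right (x : Coord Q) : mink x 0 = 0 := by simp [mink]

theorem mink_oneT (x : Coord Q) : mink x oneT = -x 3 := by simp [mink, oneT]

/-- Pairing with a fixed vector as a linear functional. -/
def minkL (u : Coord Q) : Coord Q →ₗ[Q] Q where
  toFun x := mink x u
  map_add' x y := mink_add_left x y u
  map_smul' s x := mink_smul_left s x u

@[simp] theorem minkL_apply (u x : Coord Q) : minkL u x = mink x u := rfl

/-- The null relation: `x` and `y` are connected by a light ray of speed `1`. -/
def Null (x y : Coord Q) : Prop := mink (x - y) (x - y) = 0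

theorem null_def {x y : Coord Q} : Null x y ↔ mink (x - y) (x - y) = 0 := Iff.rfl

theorem Null.symm {x y : Coord Q} (h : Null x y) : Null y x := by
  have : mink (y - x) (y - x) = mink (x - y) (x - y) := by
    simp only [mink, Pi.sub_apply]; ring
  rw [null_def, this]; exact h

theorem null_zero_right {x : Coord Q} : Null x 0 ↔ mink x x = 0 := by simp [null_def]

end Minkowski

/-! ### Geometry of null lines over an ordered field. -/

section Ordered

variable {Q : Type*} [Field Q] [LinearOrder Q] [IsStrictOrderedRing Q]

theorem eq_zero_of_mink_self {x : Coord Q} (h : mink x x = 0) (h3 : x 3 = 0) : x = 0 := by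
  simp only [mink, h3] at h
  apply ext_space_time <;> simp only [Pi.zero_apply] <;>
    first
    | exact h3
    | (refine (pow_eq_zero_iff two_ne_zero).1 ?_
       nlinarith [sq_nonneg (x 0), sq_nonneg (x 1), sq_nonneg (x 2)])

/-- Orthogonal null vectors are parallel. -/
theorem exists_smul_of_null_of_orthogonal {u v : Coord Q} (hu : mink u u = 0) (hv : mink v v = 0)
    (huv : mink u v = 0) (hu0 : u ≠ 0) : ∃ s : Q, v = s • u := by
  have h3 : u 3 ≠ 0 := fun h => hu0 (eq_zero_of_mink_self hu h)
  refine ⟨v 3 / u 3, sub_eq_zero.1 (eq_zero_of_mink_self ?_ ?_)⟩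
  · simp only [mink_sub_left, mink_sub_right, mink_smul_left, mink_smul_right, hu, hv, huv,
      mink_comm v u]
    ring
  · simp [h3]

/-- A point null related to two distinct null related points lies on the line joining them. -/
theorem exists_eq_add_smul_of_null {a b z : Coord Q} (hab : Null a b) (hne : a ≠ b)
    (ha : Null z a) (hb : Null z b) : ∃ s : Q, z = a + s • (b - a) := by
  have h1 : mink (b - a) (b - a) = 0 := hab.symm
  have h2 : mink (z - a) (z - a) = 0 := ha
  have h3 : mink (b - a) (z - a) = 0 := by
    have h : mink ((z - a) - (b - a)) ((z - a) - (b - a)) = 0 := by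
      rw [sub_sub_sub_cancel_right]; exact hb
    simp only [mink_sub_left (z - a), mink_sub_right (z - a) (b - a), h1, h2,
      mink_comm (z - a) (b - a)] at h
    linarith
  obtain ⟨s, hs⟩ := exists_smul_of_null_of_orthogonal h1 h2 h3 (sub_ne_zero.2 hne.symm)
  exact ⟨s, by rw [← hs]; abel⟩

/-- Orthogonality to a null line expressed by the null relation alone. -/
theorem mink_eq_zero_iff_null {a b : Coord Q} (hab : Null a b) (hne : a ≠ b) (x : Coord Q) :
    mink (x - a) (b - a) = 0 ↔
      (Null x a ∧ Null x b) ∨ ∀ z, Null z a → Null z b → ¬ Null x z := by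
  have h1 : mink (b - a) (b - a) = 0 := hab.symm
  -- Since `b - a` is null, the form is affine in `s` along the line. With zero slope it vanishes
  -- everywhere or nowhere; otherwise it has exactly one zero.
  have key (s : Q) : mink (x - (a + s • (b - a))) (x - (a + s • (b - a))) =
      mink (x - a) (x - a) - 2 * s * mink (x - a) (b - a) := by
    rw [← sub_sub, mink_sub_left (x - a), mink_sub_right (x - a), mink_sub_right (x - a),
      mink_smul_left, mink_smul_right, mink_smul_left, mink_smul_right, h1,
      mink_comm (b - a) (x - a)]
    ring
  have hxb : mink (x - b) (x - b) = mink (x - a) (x - a) - 2 * mink (x - a) (b - a) := by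
    have := key 1
    simpa using this
  constructor
  · intro h
    by_contra! hcon
    obtain ⟨hn, z, hza, hzb, hxz⟩ := hcon
    obtain ⟨s, rfl⟩ := exists_eq_add_smul_of_null hab hne hza hzb
    rw [null_def, key, h] at hxz
    have hxa : mink (x - a) (x - a) = 0 := by linarith
    exact hn hxa (by rw [null_def, hxb, h, hxa]; ring)
  · rintro (⟨ha, hb⟩ | h)
    · rw [null_def] at ha hb
      rw [hxb, ha] at hb
      linarith
    · by_contra hne0
      set s := mink (x - a) (x - a) / (2 * mink (x - a) (b - a)) with hs
      refine h (a + s • (b - a)) ?_ ?_ ?_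
      · rw [null_def, add_sub_cancel_left, mink_smul_left, mink_smul_right, h1]; ring
      · have : a + s • (b - a) - b = (s - 1) • (b - a) := by
          rw [sub_smul, one_smul]; abel
        rw [null_def, this, mink_smul_left, mink_smul_right, h1]; ring
      · rw [null_def, key, hs]
        field_simp
        ring

/-- Cauchy–Schwarz for the spatial parts rules out two orthogonal timelike vectors. This fixes the
sign of `κ` later. -/
theorem mink_nonneg_of_orthogonal {a b : Coord Q} (ha : mink a a < 0) (hab : mink a b = 0) :
    0 ≤ mink b b := by
  by_contra! hb
  simp only [mink] at ha hab hb
  have hcs : (a 0 * b 0 + a 1 * b 1 + a 2 * b 2) ^ 2 ≤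
      (a 0 * a 0 + a 1 * a 1 + a 2 * a 2) * (b 0 * b 0 + b 1 * b 1 + b 2 * b 2) := by
    nlinarith [sq_nonneg (a 0 * b 1 - a 1 * b 0), sq_nonneg (a 0 * b 2 - a 2 * b 0),
      sq_nonneg (a 1 * b 2 - a 2 * b 1)]
  have e : a 0 * b 0 + a 1 * b 1 + a 2 * b 2 = a 3 * b 3 := by linarith
  rw [e] at hcs
  have hA : 0 ≤ a 0 * a 0 + a 1 * a 1 + a 2 * a 2 :=
    add_nonneg (add_nonneg (mul_self_nonneg _) (mul_self_nonneg _)) (mul_self_nonneg _)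
  have hB : 0 ≤ b 0 * b 0 + b 1 * b 1 + b 2 * b 2 :=
    add_nonneg (add_nonneg (mul_self_nonneg _) (mul_self_nonneg _)) (mul_self_nonneg _)
  have := mul_lt_mul'' (sub_neg.1 ha) (sub_neg.1 hb) hA hB
  nlinarith

end Ordered

/-! ### Null vectors along the coordinate axes. -/

section AxisNullVectors

variable (Q : Type*) [Field Q]

/-- The null vector `(1, 0, 0, 1)`. -/
def nullX : Coord Q := ![1, 0, 0, 1]

/-- The null vector `(-1, 0, 0, 1)`. -/
def nullX' : Coord Q := ![-1, 0, 0, 1]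

/-- The null vector `(0, 1, 0, 1)`. -/
def nullY : Coord Q := ![0, 1, 0, 1]

/-- The null vector `(0, -1, 0, 1)`. -/
def nullY' : Coord Q := ![0, -1, 0, 1]

/-- The null vector `(0, 0, 1, 1)`. -/
def nullZ : Coord Q := ![0, 0, 1, 1]

/-- The null vector `(0, 0, -1, 1)`. -/
def nullZ' : Coord Q := ![0, 0, -1, 1]

variable {Q}

theorem eq_zero_of_mink_axis [CharZero Q] {x : Coord Q} (h1 : mink x (nullX Q) = 0)
    (h2 : mink x (nullX' Q) = 0) (h3 : mink x (nullY Q) = 0) (h4 : mink x (nullZ Q) = 0) :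
    x = 0 := by
  simp [mink, nullX, nullX', nullY, nullZ] at h1 h2 h3 h4
  have e0 : x 0 = 0 := by
    have : 2 * x 0 = 0 := by linear_combination h1 - h2
    simpa using this
  have e3 : x 3 = 0 := by linear_combination e0 - h1
  apply ext_space_time
  · exact e0
  · show x 1 = 0
    linear_combination h3 + e3
  · show x 2 = 0
    linear_combination h4 + e3
  · exact e3

theorem eq_sum_axis [CharZero Q] (y : Coord Q) :
    y = ((y 0 + y 3 - y 1 - y 2) / 2) • nullX Q + ((y 3 - y 0 - y 1 - y 2) / 2) • nullX' Q +
      y 1 • nullY Q + y 2 • nullZ Q := by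
  apply ext_space_time <;> simp [nullX, nullX', nullY, nullZ] <;> ring

theorem mink_axis_self :
    mink (nullX Q) (nullX Q) = 0 ∧ mink (nullX' Q) (nullX' Q) = 0 ∧
      mink (nullY Q) (nullY Q) = 0 ∧ mink (nullZ Q) (nullZ Q) = 0 := by
  refine ⟨?_, ?_, ?_, ?_⟩ <;> simp [mink, nullX, nullX', nullY, nullZ]

end AxisNullVectors

/-! ### The Alexandrov–Zeeman theorem over a Euclidean field. -/

section NullPreserving

/-- A bijection of space-time that preserves the null relation in both directions. -/
structure NullPreserving {Q : Type*} [Field Q] (g : Coord Q → Coord Q) : Prop where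
  bij : Function.Bijective g
  null_iff : ∀ x y, Null x y ↔ Null (g x) (g y)

theorem NullPreserving.null_image {Q : Type*} [Field Q] {g : Coord Q → Coord Q}
    (hg : NullPreserving g) {u : Coord Q} (hu : mink u u = 0) (a : Coord Q) :
    mink (g (a + u) - g a) (g (a + u) - g a) = 0 :=
  (hg.null_iff (a + u) a).1 (by simpa [null_def] using hu)

variable {Q : Type*} [Field Q] [LinearOrder Q] [IsStrictOrderedRing Q]
  {g : Coord Q → Coord Q}

namespace NullPreserving

/-- The criterion `mink_eq_zero_iff_null` mentions only the null relation and a quantifier over all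
points, so a null-preserving bijection transports it. -/
theorem tangent_iff (hg : NullPreserving g) {a b : Coord Q} (hab : Null a b) (hne : a ≠ b)
    (x : Coord Q) :
    mink (x - a) (b - a) = 0 ↔ mink (g x - g a) (g b - g a) = 0 := by
  rw [mink_eq_zero_iff_null hab hne,
    mink_eq_zero_iff_null ((hg.null_iff _ _).1 hab) (hg.bij.1.ne hne), ← hg.null_iff, ← hg.null_iff,
    hg.bij.2.forall (p := fun z => Null z (g a) → Null z (g b) → ¬ Null (g x) z)]
  simp only [← hg.null_iff]

theorem tangent_add_iff (hg : NullPreserving g) {u : Coord Q} (hu : mink u u = 0) (hu0 : u ≠ 0)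
    (x a : Coord Q) :
    mink (x - a) u = 0 ↔ mink (g x - g a) (g (a + u) - g a) = 0 := by
  have h := hg.tangent_iff (a := a) (b := a + u)
    (Null.symm (by simpa [null_def] using hu)) (by simpa using hu0) x
  simpa using h

theorem image_ne (hg : NullPreserving g) {u : Coord Q} (hu0 : u ≠ 0) (a : Coord Q) :
    g (a + u) - g a ≠ 0 :=
  sub_ne_zero.2 (hg.bij.1.ne (by simpa using hu0))

theorem parallel_of_mink_ne_zero (hg : NullPreserving g) {u : Coord Q} (hu : mink u u = 0)
    (hu0 : u ≠ 0) {a b : Coord Q} (hab : mink (b - a) u ≠ 0) :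
    ∃ k : Q, g (a + u) - g a = k • (g (b + u) - g b) := by
  refine exists_smul_of_null_of_orthogonal (hg.null_image hu b) (hg.null_image hu a) ?_
    (hg.image_ne hu0 b)
  by_contra hne
  set m := g (a + u) - g a with hm
  set n := g (b + u) - g b with hn
  -- If `m` and `n` were not orthogonal, the null line through `g a` along `m` would meet the image
  -- of the hyperplane through `b`. The preimage of that point would lie on two disjoint parallel
  -- hyperplanes.
  obtain ⟨z, hz⟩ := hg.bij.2 (g a + (mink (g b - g a) n / mink n m) • m)
  have ha : mink (z - a) u = 0 := by
    rw [hg.tangent_add_iff hu hu0, ← hm, hz, add_sub_cancel_left, mink_smul_left,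
      hg.null_image hu a, mul_zero]
  have hb : mink (z - b) u = 0 := by
    rw [hg.tangent_add_iff hu hu0, ← hn, hz, add_sub_right_comm, mink_add_left, mink_smul_left,
      mink_comm m n, div_mul_cancel₀ _ hne, ← mink_add_left]
    simp
  apply hab
  rw [← sub_sub_sub_cancel_left a b z, mink_sub_left, ha, hb, sub_zero]

/-- Parallel null segments are mapped to parallel null segments. -/
theorem parallel (hg : NullPreserving g) {u : Coord Q} (hu : mink u u = 0)
    (hu0 : u ≠ 0) (a b : Coord Q) :
    ∃ k : Q, g (a + u) - g a = k • (g (b + u) - g b) := by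
  by_cases hab : mink (b - a) u = 0
  · have h3 : u 3 ≠ 0 := fun h => hu0 (eq_zero_of_mink_self hu h)
    have hw : mink oneT u ≠ 0 := by
      rw [mink_comm, mink_oneT]; simpa using h3
    -- When `a` and `b` lie on the same hyperplane, pass through `a + oneT`, which lies off it.
    obtain ⟨k, hk⟩ := hg.parallel_of_mink_ne_zero hu hu0 (a := a) (b := a + oneT)
      (by simpa using hw)
    obtain ⟨l, hl⟩ := hg.parallel_of_mink_ne_zero hu hu0 (a := a + oneT) (b := b)
      (by rw [← sub_sub, mink_sub_left, hab]; simpa using hw)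
    exact ⟨k * l, by rw [hk, hl, smul_smul]⟩
  · exact hg.parallel_of_mink_ne_zero hu hu0 hab

theorem orthogonal_iff (hg : NullPreserving g) (g0 : g 0 = 0) {u : Coord Q} (hu : mink u u = 0)
    (hu0 : u ≠ 0) (x y : Coord Q) :
    mink (x - y) u = 0 ↔ mink (g x - g y) (g u) = 0 := by
  rw [hg.tangent_add_iff hu hu0]
  obtain ⟨k, hk⟩ := hg.parallel hu hu0 y 0
  rw [zero_add, g0, sub_zero] at hk
  have hk0 : k ≠ 0 := by
    rintro rfl
    exact hg.image_ne hu0 y (by rw [hk, zero_smul])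
  rw [hk, mink_smul_right, mul_eq_zero, or_iff_right hk0]

/-- The function `φ` with `mink (g x) (g u) = φ (mink x u)` for a null vector `u`. -/
def transfer (g : Coord Q → Coord Q) (u : Coord Q) (s : Q) : Q :=
  mink (g ((-(s / u 3)) • oneT)) (g u)

/-- By `orthogonal_iff` the left side depends on `x` only through `mink x u`; `transfer` evaluates
it at the multiple of `oneT` having that product with `u`. -/
theorem mink_image (hg : NullPreserving g) (g0 : g 0 = 0) {u : Coord Q} (hu : mink u u = 0)
    (hu0 : u ≠ 0) (x : Coord Q) : mink (g x) (g u) = transfer g u (mink x u) := by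
  have h3 : u 3 ≠ 0 := fun h => hu0 (eq_zero_of_mink_self hu h)
  rw [transfer, ← sub_eq_zero, ← mink_sub_left, ← hg.orthogonal_iff g0 hu hu0, mink_sub_left,
    mink_smul_left, mink_comm oneT, mink_oneT]
  field_simp
  simp

theorem transfer_eq_zero_iff (hg : NullPreserving g) (g0 : g 0 = 0) {u : Coord Q}
    (hu : mink u u = 0) (hu0 : u ≠ 0) (s : Q) : transfer g u s = 0 ↔ s = 0 := by
  have h3 : u 3 ≠ 0 := fun h => hu0 (eq_zero_of_mink_self hu h)
  have h := hg.orthogonal_iff g0 hu hu0 ((-(s / u 3)) • oneT) 0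
  rw [g0, sub_zero, sub_zero] at h
  rw [transfer, ← h, mink_smul_left, mink_comm, mink_oneT]
  field_simp

/-- A vector `g x` orthogonal to `g u`, `g v`, `g w` is orthogonal to `g (u + v - w)`, so the last
functional is a combination of the other three. Evaluating at points with prescribed products `s`,
`t`, `0` splits the transfer function into a part in `s` and a part in `t`. -/
theorem transfer_add_of_sum (hg : NullPreserving g) (g0 : g 0 = 0) {u v w : Coord Q}
    (hu : mink u u = 0) (hv : mink v v = 0) (hw : mink w w = 0) (huv : mink u v = -2)
    (huw : mink u w = -1) (hvw : mink v w = -1) (s t : Q) :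
    transfer g (u + v - w) (s + t) = transfer g (u + v - w) s + transfer g (u + v - w) t := by
  have hu0 : u ≠ 0 := by rintro rfl; simp at huw
  have hv0 : v ≠ 0 := by rintro rfl; simp at hvw
  have hw0 : w ≠ 0 := by rintro rfl; simp at huw
  have hq : mink (u + v - w) (u + v - w) = 0 := by
    simp only [mink_add_left, mink_sub_left, mink_add_right, mink_sub_right, hu, hv, hw, huv, huw,
      hvw, mink_comm v u, mink_comm w u, mink_comm w v]
    ring
  have hq0 : u + v - w ≠ 0 := by
    intro h
    have : mink (u + v - w) w = 0 := by rw [h, mink_zero_left]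
    rw [mink_sub_left, mink_add_left, huw, hvw, hw] at this
    norm_num at this
  have hspan : minkL (g (u + v - w)) ∈
      Submodule.span Q (Set.range ![minkL (g u), minkL (g v), minkL (g w)]) := by
    refine mem_span_of_iInf_ker_le_ker fun z hz => ?_
    obtain ⟨x, rfl⟩ := hg.bij.2 z
    simp only [Submodule.mem_iInf, LinearMap.mem_ker] at hz ⊢
    have h0 : mink x u = 0 := by
      have := hz 0
      simpa [hg.mink_image g0 hu hu0, hg.transfer_eq_zero_iff g0 hu hu0] using this
    have h1 : mink x v = 0 := by
      have := hz 1
      simpa [hg.mink_image g0 hv hv0, hg.transfer_eq_zero_iff g0 hv hv0] using this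
    have h2 : mink x w = 0 := by
      have := hz 2
      simpa [hg.mink_image g0 hw hw0, hg.transfer_eq_zero_iff g0 hw hw0] using this
    rw [minkL_apply, hg.mink_image g0 hq hq0, hg.transfer_eq_zero_iff g0 hq hq0, mink_sub_right,
      mink_add_right, h0, h1, h2]
    ring
  obtain ⟨c, hc⟩ := (Submodule.mem_span_range_iff_exists_fun Q).1 hspan
  have main (s t : Q) : transfer g (u + v - w) (s + t) =
      c 0 * transfer g u s + c 1 * transfer g v t := by
    -- The coefficients solve the Gram system `mink x u = s`, `mink x v = t`, `mink x w = 0`.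
    let γ : Q := -(s + t) / 2
    let x : Coord Q := (-(t + γ) / 2) • u + (-(s + γ) / 2) • v + γ • w
    have h0 : mink x u = s := by
      simp only [x, γ, mink_add_left, mink_smul_left, hu, huv, huw, mink_comm v u, mink_comm w u]
      ring
    have h1 : mink x v = t := by
      simp only [x, γ, mink_add_left, mink_smul_left, hv, huv, hvw, mink_comm w v]
      ring
    have h2 : mink x w = 0 := by
      simp only [x, γ, mink_add_left, mink_smul_left, hw, huw, hvw]
      ring
    have h := LinearMap.congr_fun hc (g x)
    simp [Fin.sum_univ_three] at h
    rw [hg.mink_image g0 hu hu0, hg.mink_image g0 hv hv0, hg.mink_image g0 hw hw0,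
      hg.mink_image g0 hq hq0, h0, h1, h2, (hg.transfer_eq_zero_iff g0 hw hw0 0).2 rfl, mul_zero,
      add_zero, mink_sub_right, mink_add_right, h0, h1, h2, sub_zero] at h
    exact h.symm
  have e1 := main s 0
  have e2 := main 0 t
  rw [(hg.transfer_eq_zero_iff g0 hv hv0 0).2 rfl, mul_zero, add_zero, add_zero] at e1
  rw [(hg.transfer_eq_zero_iff g0 hu hu0 0).2 rfl, mul_zero, zero_add, zero_add] at e2
  rw [main, e1, e2]

theorem mink_image_add (hg : NullPreserving g) (g0 : g 0 = 0) {u v w q : Coord Q}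
    (hu : mink u u = 0) (hv : mink v v = 0) (hw : mink w w = 0) (huv : mink u v = -2)
    (huw : mink u w = -1) (hvw : mink v w = -1) (hq : q = u + v - w) (x y : Coord Q) :
    mink (g (x + y) - g x - g y) (g q) = 0 := by
  have h := hg.transfer_add_of_sum g0 hu hv hw huv huw hvw (mink x q) (mink y q)
  rw [← hq] at h
  have hqq : mink q q = 0 := by
    simp only [hq, mink_add_left, mink_sub_left, mink_add_right, mink_sub_right, hu, hv, hw, huv,
      huw, hvw, mink_comm v u, mink_comm w u, mink_comm w v]
    ring
  have hq0 : q ≠ 0 := by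
    intro h
    have : mink q w = 0 := by rw [h, mink_zero_left]
    rw [hq, mink_sub_left, mink_add_left, huw, hvw, hw] at this
    norm_num at this
  simp only [mink_sub_left, hg.mink_image g0 hqq hq0, mink_add_left, h]
  ring

theorem axis_ne_zero :
    nullX Q ≠ 0 ∧ nullX' Q ≠ 0 ∧ nullY Q ≠ 0 ∧ nullZ Q ≠ 0 := by
  refine ⟨?_, ?_, ?_, ?_⟩ <;> intro h <;> have := congrFun h 3 <;>
    simp [nullX, nullX', nullY, nullZ] at this

/-- Each axis null vector has the form `u + v - w`, for instance `nullX = nullY + nullY' - nullX'`.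
Hence the additivity defect, written as `g z`, is orthogonal to the images of four spanning null
vectors, which forces `z = 0`. -/
theorem image_add (hg : NullPreserving g) (g0 : g 0 = 0) (x y : Coord Q) :
    g (x + y) = g x + g y := by
  obtain ⟨nX, nX', nY, nZ⟩ := axis_ne_zero (Q := Q)
  obtain ⟨sX, sX', sY, sZ⟩ := mink_axis_self (Q := Q)
  obtain ⟨z, hz⟩ := hg.bij.2 (g (x + y) - g x - g y)
  have hX : mink z (nullX Q) = 0 := by
    rw [← hg.transfer_eq_zero_iff g0 sX nX, ← hg.mink_image g0 sX nX, hz]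
    apply hg.mink_image_add g0 (u := nullY Q) (v := nullY' Q) (w := nullX' Q) <;>
      first
      | (apply ext_space_time <;> simp [nullX, nullY, nullY', nullX'])
      | (simp [mink, nullY, nullY', nullX'] <;> norm_num)
  have hX' : mink z (nullX' Q) = 0 := by
    rw [← hg.transfer_eq_zero_iff g0 sX' nX', ← hg.mink_image g0 sX' nX', hz]
    apply hg.mink_image_add g0 (u := nullY Q) (v := nullY' Q) (w := nullX Q) <;>
      first
      | (apply ext_space_time <;> simp [nullX, nullY, nullY', nullX'])
      | (simp [mink, nullY, nullY', nullX] <;> norm_num)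
  have hY : mink z (nullY Q) = 0 := by
    rw [← hg.transfer_eq_zero_iff g0 sY nY, ← hg.mink_image g0 sY nY, hz]
    apply hg.mink_image_add g0 (u := nullX Q) (v := nullX' Q) (w := nullY' Q) <;>
      first
      | (apply ext_space_time <;> simp [nullX, nullY, nullY', nullX'])
      | (simp [mink, nullX, nullY', nullX'] <;> norm_num)
  have hZ : mink z (nullZ Q) = 0 := by
    rw [← hg.transfer_eq_zero_iff g0 sZ nZ, ← hg.mink_image g0 sZ nZ, hz]
    apply hg.mink_image_add g0 (u := nullX Q) (v := nullX' Q) (w := nullZ' Q) <;>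
      first
      | (apply ext_space_time <;> simp [nullX, nullZ, nullZ', nullX'])
      | (simp [mink, nullX, nullZ', nullX'] <;> norm_num)
  rw [eq_zero_of_mink_axis hX hX' hY hZ, g0] at hz
  rw [← sub_eq_zero, ← sub_sub, ← hz]

theorem exists_smul_image (hg : NullPreserving g) (g0 : g 0 = 0) {u : Coord Q}
    (hu : mink u u = 0) (hu0 : u ≠ 0) (s : Q) : ∃ k : Q, g (s • u) = k • g u := by
  have h : Null (s • u) 0 := by
    rw [null_zero_right, mink_smul_left, mink_smul_right, hu]; ring
  have h' : Null (s • u) u := by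
    have : s • u - u = (s - 1) • u := by rw [sub_smul, one_smul]
    rw [null_def, this, mink_smul_left, mink_smul_right, hu]; ring
  obtain ⟨k, hk⟩ := exists_eq_add_smul_of_null (a := g 0) (b := g u) (z := g (s • u))
    ((hg.null_iff _ _).1 (Null.symm (null_zero_right.2 hu))) (hg.bij.1.ne hu0.symm)
    ((hg.null_iff _ _).1 h) ((hg.null_iff _ _).1 h')
  exact ⟨k, by simpa [g0] using hk⟩

/-- Null vectors with the same nonzero product with a third one are scaled alike. -/
theorem smul_image_congr (hg : NullPreserving g) (g0 : g 0 = 0) {u v w : Coord Q}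
    (hv : mink v v = 0) (hw : mink w w = 0)
    (hne : mink u w ≠ 0) (huv : mink v w = mink u w) {s k : Q} (hk : g (s • u) = k • g u) :
    g (s • v) = k • g v := by
  have hv0 : v ≠ 0 := by rintro rfl; rw [mink_zero_left] at huv; exact hne huv.symm
  have hw0 : w ≠ 0 := by rintro rfl; simp at hne
  obtain ⟨l, hl⟩ := hg.exists_smul_image g0 hv hv0 s
  have h1 : mink (g (s • u)) (g w) = mink (g (s • v)) (g w) := by
    rw [hg.mink_image g0 hw hw0, hg.mink_image g0 hw hw0, mink_smul_left, mink_smul_left, huv]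
  have h2 : mink (g v) (g w) = mink (g u) (g w) := by
    rw [hg.mink_image g0 hw hw0, hg.mink_image g0 hw hw0, huv]
  have h3 : mink (g u) (g w) ≠ 0 := by
    rwa [hg.mink_image g0 hw hw0, Ne, hg.transfer_eq_zero_iff g0 hw hw0]
  rw [hk, hl, mink_smul_left, mink_smul_left, h2] at h1
  rw [hl, mul_right_cancel₀ h3 h1]

theorem mink_image_eq_mul (hg : NullPreserving g) (g0 : g 0 = 0) {v w : Coord Q}
    (hw : mink w w = 0) (hvw : mink v w = -1) {ψ : Q →+ Q}
    (hψ : ∀ s, g (s • v) = ψ s • g v) (x : Coord Q) :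
    mink (g x) (g w) = -mink (g v) (g w) * ψ (mink x w) := by
  have hw0 : w ≠ 0 := by rintro rfl; simp at hvw
  have h : mink (g ((-mink x w) • v)) (g w) = mink (g x) (g w) := by
    rw [hg.mink_image g0 hw hw0, hg.mink_image g0 hw hw0 x, mink_smul_left, hvw]
    congr 1; ring
  rw [← h, hψ, mink_smul_left, map_neg]
  ring

/-- An additive map of an ordered field that respects multiplication by the elements of
`[0, 1]` is multiplicative. -/
theorem map_mul_of_unit_interval {ψ : Q →+ Q} (h1 : ψ 1 = 1)
    (h : ∀ s k : Q, 0 ≤ k → k ≤ 1 → ψ (s * k) = ψ s * ψ k) (s k : Q) :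
    ψ (s * k) = ψ s * ψ k := by
  have pos (s k : Q) (hk : 0 ≤ k) : ψ (s * k) = ψ s * ψ k := by
    rcases le_total k 1 with hk1 | hk1
    · exact h s k hk hk1
    · have hk0 : k ≠ 0 := by positivity
      have hi : 0 ≤ k⁻¹ := inv_nonneg.2 hk
      have hi1 : k⁻¹ ≤ 1 := inv_le_one_of_one_le₀ hk1
      have e1 := h k k⁻¹ hi hi1
      have e2 := h (s * k) k⁻¹ hi hi1
      rw [mul_inv_cancel₀ hk0, h1] at e1
      rw [mul_assoc, mul_inv_cancel₀ hk0, mul_one] at e2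
      rw [e2, mul_assoc, mul_comm (ψ k⁻¹), ← e1, mul_one]
  rcases le_total 0 k with hk | hk
  · exact pos s k hk
  · have := pos s (-k) (neg_nonneg.2 hk)
    rw [mul_neg, map_neg, map_neg, mul_neg] at this
    exact neg_injective this

/-- A bijection fixing the origin and preserving the null relation transforms the Minkowski form
by a field endomorphism and a scalar factor. -/
theorem exists_ringHom_of_map_zero (hQ : AxEField Q) (hg : NullPreserving g) (g0 : g 0 = 0) :
    ∃ (ψ : Q →+* Q) (κ : Q), 0 < κ ∧ ∀ x y, mink (g x) (g y) = κ * ψ (mink x y) := by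
  obtain ⟨nX, nX', nY, nZ⟩ := axis_ne_zero (Q := Q)
  obtain ⟨sX, sX', sY, sZ⟩ := mink_axis_self (Q := Q)
  have XY : mink (nullX Q) (nullY Q) = -1 := by simp [mink, nullX, nullY]
  have XZ : mink (nullX Q) (nullZ Q) = -1 := by simp [mink, nullX, nullZ]
  have X'Y : mink (nullX' Q) (nullY Q) = -1 := by simp [mink, nullX', nullY]
  have YZ : mink (nullY Q) (nullZ Q) = -1 := by simp [mink, nullY, nullZ]
  have gX : g (nullX Q) ≠ 0 := by rw [← g0]; exact hg.bij.1.ne nX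
  choose ψ₀ hψ₀ using hg.exists_smul_image g0 sX nX
  let ψ₁ : Q →+ Q := AddMonoidHom.mk' ψ₀ fun s t => by
    have h := hg.image_add g0 (s • nullX Q) (t • nullX Q)
    rw [← add_smul, hψ₀, hψ₀, hψ₀, ← add_smul] at h
    exact smul_left_injective Q gX h
  have hX (s : Q) : g (s • nullX Q) = ψ₁ s • g (nullX Q) := hψ₀ s
  have one : ψ₁ 1 = 1 := by
    have h := hX 1
    rw [one_smul] at h
    exact (smul_left_injective Q gX (by simpa using h)).symm
  -- The map `ψ₁` read off on `nullX` serves the other axes too, because each shares with `nullX`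
  -- its product with some third null vector.
  have hX' (s : Q) : g (s • nullX' Q) = ψ₁ s • g (nullX' Q) :=
    hg.smul_image_congr g0 sX' sY (by rw [XY]; simp) (by rw [X'Y, XY]) (hX s)
  have hY (s : Q) : g (s • nullY Q) = ψ₁ s • g (nullY Q) :=
    hg.smul_image_congr g0 sY sZ (by rw [XZ]; simp) (by rw [YZ, XZ]) (hX s)
  have hZ (s : Q) : g (s • nullZ Q) = ψ₁ s • g (nullZ Q) :=
    hg.smul_image_congr g0 sZ sY (by rw [XY]; simp) (by rw [mink_comm, YZ, XY]) (hX s)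
  let κ : Q := -mink (g (nullX Q)) (g (nullY Q))
  have kX (x : Coord Q) : mink (g x) (g (nullX Q)) = κ * ψ₁ (mink x (nullX Q)) := by
    rw [hg.mink_image_eq_mul g0 sX (by rw [mink_comm, XY]) hY, mink_comm (g (nullY Q))]
  have kY (x : Coord Q) : mink (g x) (g (nullY Q)) = κ * ψ₁ (mink x (nullY Q)) :=
    hg.mink_image_eq_mul g0 sY XY hX x
  have kX' (x : Coord Q) : mink (g x) (g (nullX' Q)) = κ * ψ₁ (mink x (nullX' Q)) := by
    rw [hg.mink_image_eq_mul g0 sX' (by rw [mink_comm, X'Y]) hY, mink_comm (g (nullY Q)), kY, X'Y,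
      map_neg, one]
    ring
  have kZ (x : Coord Q) : mink (g x) (g (nullZ Q)) = κ * ψ₁ (mink x (nullZ Q)) := by
    rw [hg.mink_image_eq_mul g0 sZ XZ hX, mink_comm, kX, mink_comm, XZ, map_neg, one]
    ring
  have κ0 : κ ≠ 0 := by
    rw [neg_ne_zero, hg.mink_image g0 sY nY, Ne, hg.transfer_eq_zero_iff g0 sY nY, XY]
    simp
  -- The null vector `v` has product `-k` with `nullX` and is also scaled by `ψ₁`; computing `mink
  -- (g (s • v)) (g (nullX Q))` in two ways gives multiplicativity. The square root needed for `v`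
  -- restricts `k`.
  have mul := map_mul_of_unit_interval one fun s k hk hk1 => by
    obtain ⟨-, hb⟩ := sqrt_spec hQ (a := 1 - (1 - k) ^ 2) (by nlinarith)
    set b := sqrt (1 - (1 - k) ^ 2)
    let v : Coord Q := ![1 - k, b, 0, 1]
    have sv : mink v v = 0 := by
      simp [mink, v]
      linear_combination hb
    have hv := hg.smul_image_congr g0 sv sZ (by rw [XZ]; simp)
      (by rw [XZ]; simp [mink, v, nullZ]) (hX s)
    have vX : mink v (nullX Q) = -k := by
      simp [mink, v, nullX]
    have h := kX (s • v)
    rw [hv, mink_smul_left, mink_smul_left, kX, vX, mul_neg, map_neg, map_neg] at h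
    apply mul_left_cancel₀ κ0
    linear_combination h
  let ψ : Q →+* Q :=
    { ψ₁ with
      map_one' := one
      map_mul' := mul }
  have form (x y : Coord Q) : mink (g x) (g y) = κ * ψ (mink x y) := by
    show mink (g x) (g y) = κ * ψ₁ (mink x y)
    rw [eq_sum_axis y]
    simp only [hg.image_add g0, hX, hX', hY, hZ, mink_add_right, mink_smul_right, kX, kX', kY, kZ,
      map_add, mul]
    ring
  refine ⟨ψ, κ, ?_, form⟩
  -- For negative `κ`, two orthogonal spatial unit vectors would have orthogonal timelike images.
  by_contra! hκ
  have hκ : κ < 0 := lt_of_le_of_ne hκ κ0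
  have h1 := form ![1, 0, 0, 0] ![1, 0, 0, 0]
  have h2 := form ![1, 0, 0, 0] ![0, 1, 0, 0]
  have h3 := form ![0, 1, 0, 0] ![0, 1, 0, 0]
  have e1 : mink (![1, 0, 0, 0] : Coord Q) ![1, 0, 0, 0] = 1 := by simp [mink]
  have e2 : mink (![1, 0, 0, 0] : Coord Q) ![0, 1, 0, 0] = 0 := by simp [mink]
  have e3 : mink (![0, 1, 0, 0] : Coord Q) ![0, 1, 0, 0] = 1 := by simp [mink]
  rw [e1, map_one, mul_one] at h1
  rw [e2, map_zero, mul_zero] at h2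
  rw [e3, map_one, mul_one] at h3
  have := mink_nonneg_of_orthogonal (h1 ▸ hκ) h2
  linarith

/-- The Alexandrov–Zeeman theorem over a Euclidean field, stated for the Minkowski form. -/
theorem exists_ringHom (hQ : AxEField Q) {f : Coord Q → Coord Q} (hf : NullPreserving f) :
    ∃ (ψ : Q →+* Q) (κ : Q), 0 < κ ∧ ∀ x y z t,
      mink (f x - f y) (f z - f t) = κ * ψ (mink (x - y) (z - t)) := by
  let g : Coord Q → Coord Q := fun x => f x - f 0
  have g0 : g 0 = 0 := sub_self _
  have hg : NullPreserving g := by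
    refine ⟨⟨fun x y h => hf.bij.1 (sub_left_injective h), fun y => ?_⟩, fun x y => ?_⟩
    · obtain ⟨x, hx⟩ := hf.bij.2 (y + f 0)
      exact ⟨x, by simp [g, hx]⟩
    · rw [hf.null_iff, null_def, null_def]
      simp [g]
  have sub (x y : Coord Q) : f x - f y = g (x - y) := by
    have h := hg.image_add g0 (x - y) y
    rw [sub_add_cancel] at h
    have e : f x - f y = g x - g y := by simp [g]
    rw [e, h, add_sub_cancel_right]
  obtain ⟨ψ, κ, hκ, h⟩ := hg.exists_ringHom_of_map_zero hQ g0
  exact ⟨ψ, κ, hκ, fun x y z t => by rw [sub, sub, h]⟩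

end NullPreserving

/-- Positive elements are squares, and ring homomorphisms send squares to squares. -/
theorem ringHom_strictMono (hQ : AxEField Q) (ψ : Q →+* Q) : StrictMono ψ := by
  intro a b hab
  obtain ⟨y, hy⟩ := hQ (b - a) (sub_pos.2 hab)
  have hne : ψ (b - a) ≠ 0 := by
    rw [map_ne_zero]; exact (sub_pos.2 hab).ne'
  rw [← sub_pos, ← map_sub]
  refine lt_of_le_of_ne ?_ hne.symm
  rw [hy, map_pow]
  exact sq_nonneg _

theorem ringHom_abs (hQ : AxEField Q) (ψ : Q →+* Q) (x : Q) : |ψ x| = ψ |x| := by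
  have h := (ringHom_strictMono hQ ψ).monotone
  rcases le_total 0 x with hx | hx
  · rw [abs_of_nonneg hx, abs_of_nonneg (by simpa using h hx)]
  · rw [abs_of_nonpos hx, abs_of_nonpos (by simpa using h hx), map_neg]

theorem ringHom_eq_of_pos {ψ : Q →+* Q} (h : ∀ x, 0 < x → ψ x = x) (x : Q) : ψ x = x := by
  rcases lt_trichotomy x 0 with hx | rfl | hx
  · have := h (-x) (neg_pos.2 hx)
    rw [map_neg] at this
    exact neg_injective this
  · exact map_zero ψ
  · exact h x hx

end NullPreserving

theorem eq_of_strictMono_of_involution {Q : Type*} [LinearOrder Q]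
    {φ : Q → Q} (hφ : StrictMono φ) {x : Q}
    (h : φ (φ x) = x) : φ x = x := by
  rcases lt_trichotomy (φ x) x with hx | hx | hx
  · have := hφ hx; rw [h] at this; exact absurd this hx.not_gt
  · exact hx
  · have := hφ hx; rw [h] at this; exact absurd this hx.not_gt

/-! ### Reduction to light speed one, and distances in terms of the form. -/

section Scaling

variable {Q : Type*} [Field Q]

/-- Rescaling of time that turns light speed `c` into `1`. -/
def scale (c : Q) : Coord Q →ₗ[Q] Coord Q where
  toFun x := ![x 0, x 1, x 2, c * x 3]
  map_add' x y := by apply ext_space_time <;> simp [mul_add]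
  map_smul' s x := by apply ext_space_time <;> simp [mul_left_comm]

theorem scale_scale_inv {c : Q} (hc : c ≠ 0) (x : Coord Q) : scale c (scale c⁻¹ x) = x := by
  apply ext_space_time <;> simp [scale, hc]

theorem scale_inv_scale {c : Q} (hc : c ≠ 0) (x : Coord Q) : scale c⁻¹ (scale c x) = x := by
  apply ext_space_time <;> simp [scale, hc]

theorem scale_injective {c : Q} (hc : c ≠ 0) : Function.Injective (scale c) :=
  Function.LeftInverse.injective (scale_inv_scale hc)

/-- The Minkowski form for light speed `c`. -/
def minkc (c : Q) (x y : Coord Q) : Q := mink (scale c x) (scale c y)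

theorem minkc_eq (c : Q) (x y : Coord Q) :
    minkc c x y = x 0 * y 0 + x 1 * y 1 + x 2 * y 2 - c ^ 2 * (x 3 * y 3) := by
  simp [minkc, mink, scale]; ring

theorem minkc_oneT (c : Q) (x : Coord Q) : minkc c x oneT = -c ^ 2 * x 3 := by
  simp [minkc_eq, oneT]

theorem minkc_comm (c : Q) (x y : Coord Q) : minkc c x y = minkc c y x := mink_comm _ _

theorem minkc_smul_left (c s : Q) (x y : Coord Q) : minkc c (s • x) y = s * minkc c x y := by
  simp only [minkc, map_smul, mink_smul_left]

end Scaling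

section Distance

variable {Q : Type*} [Field Q] [LinearOrder Q] [IsStrictOrderedRing Q]

theorem sqrt_eq_iff (hQ : AxEField Q) {a d : Q} (ha : 0 ≤ a) (hd : 0 ≤ d) :
    sqrt a = d ↔ a = d ^ 2 := by
  obtain ⟨h1, h2⟩ := sqrt_spec hQ ha
  constructor
  · rintro rfl; exact h2.symm
  · intro h
    exact (pow_left_inj₀ h1 hd two_ne_zero).1 (h2.trans h)

theorem dist_eq_mul_time_iff (hQ : AxEField Q) {c : Q} (hc : 0 < c) (x y : Coord Q) :
    dist x y = c * time x y ↔ Null (scale c x) (scale c y) := by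
  rw [dist, time, sqrt_eq_iff hQ (by positivity) (mul_nonneg hc.le (abs_nonneg _)), mul_pow,
    sq_abs, null_def, ← map_sub, ← minkc, minkc_eq, ← sub_eq_zero]
  simp only [Pi.sub_apply, ← sq]

theorem time_eq_zero_iff (x y : Coord Q) : time x y = 0 ↔ (x - y) 3 = 0 := by
  rw [time, abs_eq_zero, Pi.sub_apply]

theorem dist_sq (hQ : AxEField Q) (c : Q) {x y : Coord Q} (h : time x y = 0) :
    dist x y ^ 2 = minkc c (x - y) (x - y) := by
  rw [dist, (sqrt_spec hQ (by positivity)).2, minkc_eq, (time_eq_zero_iff x y).1 h]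
  simp only [Pi.sub_apply]
  ring

theorem dist_nonneg (hQ : AxEField Q) (x y : Coord Q) : 0 ≤ dist x y :=
  (sqrt_spec hQ (by positivity)).1

end Distance

/-! ### Worldview transformations and the two symmetry axioms. -/

namespace Frame

variable {B Q : Type*} [Field Q] [LinearOrder Q] {M : Frame B Q}

/-- `c` is the speed of light for observer `i`. -/
def LightSpeed (M : Frame B Q) (i : B) (c : Q) : Prop :=
  0 < c ∧ ∀ x y : Coord Q,
    (∃ p ∈ M.Ph, x ∈ M.wline i p ∧ y ∈ M.wline i p) ↔ Null (scale c x) (scale c y)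

theorem LightSpeed.null_of_mem {i p : B} {c : Q} (h : M.LightSpeed i c) (hp : p ∈ M.Ph)
    {x y : Coord Q} (hx : x ∈ M.wline i p) (hy : y ∈ M.wline i p) :
    Null (scale c x) (scale c y) :=
  (h.2 x y).1 ⟨p, hp, hx, hy⟩

theorem LightSpeed.null_iff_of_ev_eq {i j : B} {c : Q} (hi : M.LightSpeed i c)
    (hj : M.LightSpeed j c) {x y x' y' : Coord Q} (hx : M.ev i x = M.ev j x')
    (hy : M.ev i y = M.ev j y') :
    Null (scale c x) (scale c y) ↔ Null (scale c x') (scale c y') := by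
  rw [← hi.2, ← hj.2]
  have ex (p : B) : x ∈ M.wline i p ↔ x' ∈ M.wline j p := Set.ext_iff.1 hx p
  have ey (p : B) : y ∈ M.wline i p ↔ y' ∈ M.wline j p := Set.ext_iff.1 hy p
  simp only [ex, ey]

variable [IsStrictOrderedRing Q]

theorem SpecRel0.exists_lightSpeed (h₀ : M.SpecRel0) {i : B} (hi : i ∈ M.IOb) :
    ∃ c, M.LightSpeed i c := by
  obtain ⟨c, hc, h⟩ := h₀.axPh i hi
  exact ⟨c, hc, fun x y => by rw [h, dist_eq_mul_time_iff h₀.axEField hc]⟩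

/-- Points of a light signal's worldline are pairwise null related, so the collinearity clause of
`HasSpeed` is automatic for light signals. -/
theorem LightSpeed.collinear_wline {i p : B} {c : Q} (h : M.LightSpeed i c) (hp : p ∈ M.Ph) :
    Collinear Q (M.wline i p) := by
  by_cases hs : (M.wline i p).Subsingleton
  · rcases hs.eq_empty_or_singleton with h | ⟨x, h⟩
    · rw [h]; exact collinear_empty Q _
    · rw [h]; exact collinear_singleton Q x
  · obtain ⟨x, hx, y, hy, hne⟩ := Set.not_subsingleton_iff.1 hs
    rw [collinear_iff_of_mem hx]
    refine ⟨y - x, fun z hz => ?_⟩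
    obtain ⟨s, hs⟩ := exists_eq_add_smul_of_null (h.null_of_mem hp hx hy)
      ((scale_injective h.1.ne').ne hne) (h.null_of_mem hp hz hx) (h.null_of_mem hp hz hy)
    rw [← map_sub, ← map_smul, ← map_add] at hs
    refine ⟨s, ?_⟩
    rw [scale_injective h.1.ne' hs, vadd_eq_add, add_comm]

theorem LightSpeed.eq_of_null {c d : Q} (hc : 0 < c) (hd : 0 < d) {x y : Coord Q} (hne : x ≠ y)
    (h : Null (scale c x) (scale c y)) (h' : Null (scale d x) (scale d y)) : c = d := by
  rw [null_def, ← map_sub, ← minkc, minkc_eq] at h h'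
  have h3 : (x - y) 3 ≠ 0 := by
    intro h3
    have := eq_zero_of_mink_self (x := x - y) (by rw [h3] at h; simpa [mink, h3] using h) h3
    exact hne (sub_eq_zero.1 this)
  have e : c ^ 2 * ((x - y) 3 * (x - y) 3) = d ^ 2 * ((x - y) 3 * (x - y) 3) := by
    linear_combination h' - h
  exact (pow_left_inj₀ hc.le hd.le two_ne_zero).1 (mul_right_cancel₀ (mul_ne_zero h3 h3) e)

theorem LightSpeed.unique (h₀ : M.SpecRel0) (hsame : M.AxSameC) {i j : B} (hi : i ∈ M.IOb)
    (hj : j ∈ M.IOb) {c d : Q} (hc : M.LightSpeed i c) (hd : M.LightSpeed j d) : c = d := by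
  have hn : Null (scale c 0) (scale c ![c, 0, 0, 1]) := by
    simp [null_def, mink, scale]
  obtain ⟨p, hp, hx, hy⟩ := (hc.2 _ _).2 hn
  have hne : (0 : Coord Q) ≠ ![c, 0, 0, 1] := fun h => by simpa using congrFun h 3
  have hs : M.HasSpeed i p c := ⟨hc.collinear_wline hp, _, hx, _, hy, hne,
    (dist_eq_mul_time_iff h₀.axEField hc.1 _ _).2 hn⟩
  obtain ⟨-, x, hx, y, hy, hne, hxy⟩ := (hsame i hi j hj p hp c).1 hs
  exact LightSpeed.eq_of_null hc.1 hd.1 hne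
    ((dist_eq_mul_time_iff h₀.axEField hc.1 _ _).1 hxy) (hd.null_of_mem hp hx hy)

/-- Points with the same event meet the same light signals and so have the same light cone. Their
rescaled difference is then orthogonal to every null vector, hence zero. -/
theorem LightSpeed.ev_injective {i : B} {c : Q} (h : M.LightSpeed i c) :
    Function.Injective (M.ev i) := by
  intro x y hxy
  have hcone (v : Coord Q) (hv : mink v v = 0) :
      mink (v - (scale c y - scale c x)) (v - (scale c y - scale c x)) = 0 := by
    obtain ⟨p, hp, hz, hx⟩ := (h.2 (scale c⁻¹ (scale c x + v)) x).2 (by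
      rw [scale_scale_inv h.1.ne']; simpa [null_def] using hv)
    have hy : y ∈ M.wline i p := by
      have : p ∈ M.ev i x := hx
      rw [hxy] at this; exact this
    have := h.null_of_mem hp hz hy
    rw [scale_scale_inv h.1.ne', null_def] at this
    rwa [show v - (scale c y - scale c x) = scale c x + v - scale c y by abel]
  have hexp (v d : Coord Q) : mink (v - d) (v - d) = mink v v - 2 * mink d v + mink d d := by
    simp only [mink, Pi.sub_apply]; ring
  have h0 := hcone 0 (by simp)
  rw [hexp, mink_zero_left, mink_zero_right] at h0
  have orth (v : Coord Q) (hv : mink v v = 0) : mink (scale c y - scale c x) v = 0 := by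
    have h1 := hcone v hv
    rw [hexp, hv] at h1
    linarith
  obtain ⟨sX, sX', sY, sZ⟩ := mink_axis_self (Q := Q)
  have := eq_zero_of_mink_axis (orth _ sX) (orth _ sX') (orth _ sY) (orth _ sZ)
  exact (scale_injective h.1.ne' (sub_eq_zero.1 this)).symm

/-- The worldview transformation between observers with the same light speed transforms the
Minkowski form by a field endomorphism and a positive factor. -/
theorem LightSpeed.exists_ringHom (h₀ : M.SpecRel0) {i j : B} (hiO : i ∈ M.IOb)
    (hjO : j ∈ M.IOb) {c : Q} (hi : M.LightSpeed i c) (hj : M.LightSpeed j c) :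
    ∃ (ψ : Q →+* Q) (κ : Q), 0 < κ ∧ ∀ x y z t x' y' z' t' : Coord Q,
      M.ev i x = M.ev j x' → M.ev i y = M.ev j y' → M.ev i z = M.ev j z' → M.ev i t = M.ev j t' →
      minkc c (x' - y') (z' - t') = κ * ψ (minkc c (x - y) (z - t)) := by
  choose w hw using h₀.axEv i hiO j hjO
  have hc : c ≠ 0 := hi.1.ne'
  have w_eq {x x' : Coord Q} (h : M.ev i x = M.ev j x') : w x = x' :=
    hj.ev_injective ((hw x).symm.trans h)
  let f : Coord Q → Coord Q := fun x => scale c (w (scale c⁻¹ x))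
  have f_scale (x : Coord Q) : f (scale c x) = scale c (w x) := by
    simp only [f, scale_inv_scale hc]
  have hf : NullPreserving f := by
    refine ⟨⟨fun x y h => ?_, fun y => ?_⟩, fun x y => ?_⟩
    · have h1 : w (scale c⁻¹ x) = w (scale c⁻¹ y) := scale_injective hc h
      have h2 : M.ev i (scale c⁻¹ x) = M.ev i (scale c⁻¹ y) := by rw [hw, hw, h1]
      exact scale_injective (inv_ne_zero hc) (hi.ev_injective h2)
    · obtain ⟨x, hx⟩ := h₀.axEv j hjO i hiO (scale c⁻¹ y)
      exact ⟨scale c x, by rw [f_scale, w_eq hx.symm, scale_scale_inv hc]⟩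
    · have := hi.null_iff_of_ev_eq hj (hw (scale c⁻¹ x)) (hw (scale c⁻¹ y))
      simpa only [scale_scale_inv hc] using this
  obtain ⟨ψ, κ, hκ, h⟩ := hf.exists_ringHom h₀.axEField
  refine ⟨ψ, κ, hκ, fun x y z t x' y' z' t' hx hy hz ht => ?_⟩
  have := h (scale c x) (scale c y) (scale c z) (scale c t)
  rw [f_scale, f_scale, f_scale, f_scale, w_eq hx, w_eq hy, w_eq hz, w_eq ht] at this
  simpa only [minkc, map_sub] using this

/-- All worldview transformations between inertial observers preserve the Minkowski form for
light speed `c`. -/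
def PreservesForm (M : Frame B Q) (c : Q) : Prop :=
  ∀ i ∈ M.IOb, ∀ j ∈ M.IOb, ∀ x y z t x' y' z' t' : Coord Q,
    M.ev i x = M.ev j x' → M.ev i y = M.ev j y' → M.ev i z = M.ev j z' → M.ev i t = M.ev j t' →
    minkc c (x' - y') (z' - t') = minkc c (x - y) (z - t)

theorem PreservesForm.axSymDist (h₀ : M.SpecRel0) {c : Q} (h : M.PreservesForm c) :
    M.AxSymDist := by
  intro i hi j hj x y x' y' hx hy ht ht'
  have hQ := h₀.axEField
  rw [← pow_left_inj₀ (dist_nonneg hQ x y) (dist_nonneg hQ x' y') two_ne_zero, dist_sq hQ c ht,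
    dist_sq hQ c ht']
  exact (h i hi j hj x y x y x' y' x' y' hx hy hx hy).symm

/-- Both time differences come from `t` times the product of the two observers' unit time vectors,
and this product is symmetric and the same in either coordinate system. -/
theorem PreservesForm.axSymTime (h₀ : M.SpecRel0) {c : Q} (hc : c ≠ 0) (h : M.PreservesForm c) :
    M.AxSymTime := by
  intro i hi j hj t a b a' b' ha hb ha' hb'
  obtain ⟨e, he⟩ := h₀.axEv j hj i hi oneT
  obtain ⟨d, hd⟩ := h₀.axEv i hi j hj oneT
  have h1 := h i hi j hj _ _ _ _ _ _ _ _ ha hb he.symm hb'.symm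
  have h2 := h j hj i hi _ _ _ _ _ _ _ _ ha' hb' hd.symm hb.symm
  have h3 := h i hi j hj _ _ _ _ _ _ _ _ he.symm hb'.symm hd hb
  simp only [sub_zero, minkc_smul_left, minkc_comm c oneT, minkc_oneT] at h1 h2 h3
  have hc2 : -c ^ 2 ≠ 0 := neg_ne_zero.2 (pow_ne_zero 2 hc)
  have key : (a - b) 3 = (a' - b') 3 := mul_left_cancel₀ hc2 (by rw [h1, h2, h3])
  simp only [time, ← Pi.sub_apply, key]

/-- By symmetry one function `p` records the clock rates in both directions, so `p t = κ * ψ (t * p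
1)` and `t * p 1 = κ * ψ (p t)`. Together these give `ψ (ψ t) = t` for `t > 0`; a strictly monotone
involution is the identity, and then `κ = 1`. -/
theorem AxSymTime.preservesForm (h₀ : M.SpecRel0) {c : Q}
    (hc : ∀ i ∈ M.IOb, M.LightSpeed i c) (h : M.AxSymTime) : M.PreservesForm c := by
  intro i hi j hj
  have hQ := h₀.axEField
  obtain ⟨ψ, κ, hκ, form⟩ := (hc i hi).exists_ringHom h₀ hi hj (hc j hj)
  have hψ := ringHom_strictMono hQ ψ
  have hc2 : 0 < c ^ 2 := pow_pos (hc i hi).1 2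
  choose w hw using h₀.axEv i hi j hj
  choose v hv using h₀.axEv j hj i hi
  let p : Q → Q := fun t => c ^ 2 * time (w (t • oneT)) (w 0)
  have hp_abs (t : Q) : p t = |minkc c (w (t • oneT) - w 0) oneT| := by
    rw [minkc_oneT, abs_mul, abs_neg, abs_of_pos hc2]; rfl
  have hp_abs' (t : Q) : p t = |minkc c (v (t • oneT) - v 0) oneT| := by
    rw [minkc_oneT, abs_mul, abs_neg, abs_of_pos hc2]
    simp only [p]
    rw [h i hi j hj t _ _ _ _ (hw _) (hw _) (hv _) (hv _)]; rfl
  have one_smul_oneT : (1 : Q) • (oneT : Coord Q) = oneT := one_smul _ _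
  have h1 (t : Q) (ht : 0 < t) : p t = κ * ψ (t * p 1) := by
    have := form _ _ _ _ _ _ _ _ (hw (t • oneT)) (hw 0) (hv ((1 : Q) • oneT)).symm (hv 0).symm
    rw [one_smul_oneT, sub_zero, sub_zero, minkc_smul_left] at this
    rw [hp_abs, this, abs_mul, abs_of_pos hκ, ringHom_abs hQ, abs_mul, abs_of_pos ht, minkc_comm,
      hp_abs', one_smul_oneT]
  have h2 (t : Q) (ht : 0 < t) : t * p 1 = κ * ψ (p t) := by
    have := form _ _ _ _ _ _ _ _ (hv (t • oneT)).symm (hv 0).symm (hw ((1 : Q) • oneT)) (hw 0)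
    rw [one_smul_oneT, sub_zero, sub_zero, minkc_smul_left] at this
    have e := congrArg abs this
    rw [abs_mul, abs_mul, abs_of_pos ht, abs_of_pos hκ, ringHom_abs hQ, ← hp_abs', minkc_comm]
      at e
    rw [hp_abs, one_smul_oneT, e]
  -- Otherwise the timelike `oneT` would have a purely spatial image, contradicting `κ > 0` and
  -- monotonicity of `ψ`.
  have hp1 : p 1 ≠ 0 := by
    intro h0
    have h3 : (w oneT - w 0) 3 = 0 := by
      rw [← time_eq_zero_iff, ← one_smul_oneT]
      exact (mul_eq_zero.1 h0).resolve_left hc2.ne'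
    have := form _ _ _ _ _ _ _ _ (hw oneT) (hw 0) (hw oneT) (hw 0)
    rw [sub_zero, minkc_oneT] at this
    have hneg : κ * ψ (-c ^ 2 * (oneT : Coord Q) 3) < 0 := by
      refine mul_neg_of_pos_of_neg hκ ?_
      rw [← map_zero ψ]
      exact hψ (by simpa [oneT] using hc2)
    rw [← this, minkc_eq, h3] at hneg
    nlinarith [sq_nonneg ((w oneT - w 0) 0), sq_nonneg ((w oneT - w 0) 1),
      sq_nonneg ((w oneT - w 0) 2)]
  have e1 : p 1 = κ * ψ (p 1) := by simpa using h2 1 one_pos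
  have hid : ∀ x, ψ x = x := ringHom_eq_of_pos fun t ht => by
    have e2 : p t = ψ t * p 1 := by
      rw [h1 t ht, map_mul]; linear_combination -ψ t * e1
    have e3 := h2 t ht
    rw [e2, map_mul] at e3
    refine eq_of_strictMono_of_involution hψ (mul_right_cancel₀ hp1 ?_)
    linear_combination ψ (ψ t) * e1 - e3
  have hκ1 : κ = 1 := by
    rw [hid] at e1
    exact mul_right_cancel₀ hp1 (by rw [← e1, one_mul])
  intro x y z t x' y' z' t' hx hy hz ht
  rw [form _ _ _ _ _ _ _ _ hx hy hz ht, hκ1, hid, one_mul]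

/-- Every vector has a nonzero purely spatial vector orthogonal to it. -/
theorem exists_spatial_orthogonal (c : Q) (m : Coord Q) :
    ∃ n : Coord Q, n 3 = 0 ∧ minkc c n m = 0 ∧ 0 < minkc c n n := by
  by_cases hm : m 0 = 0
  · exact ⟨![1, 0, 0, 0], by simp, by simp [minkc_eq, hm], by simp [minkc_eq]⟩
  · refine ⟨![m 1, -m 0, 0, 0], by simp, ?_, ?_⟩
    · simp [minkc_eq]; ring
    · simp [minkc_eq]
      nlinarith [sq_nonneg (m 1), sq_pos_of_ne_zero hm]

/-- A spatial vector orthogonal to the other observer's time axis joins events simultaneous for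
both. Rescaling it realizes every `r > 0` as a squared distance, so `r = κ * ψ r`. -/
theorem AxSymDist.preservesForm (h₀ : M.SpecRel0) {c : Q}
    (hc : ∀ i ∈ M.IOb, M.LightSpeed i c) (h : M.AxSymDist) : M.PreservesForm c := by
  intro i hi j hj
  have hQ := h₀.axEField
  obtain ⟨ψ, κ, hκ, form⟩ := (hc i hi).exists_ringHom h₀ hi hj (hc j hj)
  have hc2 : 0 < c ^ 2 := pow_pos (hc i hi).1 2
  choose w hw using h₀.axEv i hi j hj
  choose v hv using h₀.axEv j hj i hi
  obtain ⟨n, hn3, hnm, hnn⟩ := exists_spatial_orthogonal c (v oneT - v 0)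
  have key (r : Q) (hr : 0 < r) : r = κ * ψ r := by
    obtain ⟨s, hs⟩ := hQ (r / minkc c n n) (div_pos hr hnn)
    have hsr : minkc c (s • n) (s • n) = r := by
      rw [minkc_smul_left, minkc_comm, minkc_smul_left, ← mul_assoc, ← sq, ← hs,
        div_mul_cancel₀ _ hnn.ne']
    have t0 : time (s • n) 0 = 0 := by simp [time_eq_zero_iff, hn3]
    have t1 : time (w (s • n)) (w 0) = 0 := by
      have := form _ _ _ _ _ _ _ _ (hw (s • n)) (hw 0) (hv oneT).symm (hv 0).symm
      rw [sub_zero, sub_zero, minkc_smul_left, hnm, mul_zero, map_zero, mul_zero, minkc_oneT,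
        mul_eq_zero, or_iff_right (neg_ne_zero.2 hc2.ne')] at this
      rwa [time_eq_zero_iff]
    have e := form _ _ _ _ _ _ _ _ (hw (s • n)) (hw 0) (hw (s • n)) (hw 0)
    rw [← dist_sq hQ c t1, ← dist_sq hQ c t0, ← h i hi j hj _ _ _ _ (hw _) (hw _) t0 t1,
      dist_sq hQ c t0, sub_zero, hsr] at e
    exact e
  have hκ1 : κ = 1 := by simpa using (key 1 one_pos).symm
  have hid : ∀ x, ψ x = x := ringHom_eq_of_pos fun r hr => by
    have := key r hr
    rw [hκ1, one_mul] at this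
    exact this.symm
  intro x y z t x' y' z' t' hx hy hz ht
  rw [form _ _ _ _ _ _ _ _ hx hy hz ht, hκ1, hid, one_mul]

end Frame

end SpecRel

theorem proposition4 {B Q : Type*} [Field Q] [LinearOrder Q] [IsStrictOrderedRing Q]
    (M : SpecRel.Frame B Q) (h₀ : M.SpecRel0) (hc : M.AxSameC) :
    M.AxSymTime ↔ M.AxSymDist := by
  -- An observer is needed to supply the common light speed; without one both axioms are vacuous.
  rcases M.IOb.eq_empty_or_nonempty with he | ⟨k, hk⟩
  · constructor <;> intro _ i hi <;> simp [he] at hi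
  obtain ⟨c, hkc⟩ := h₀.exists_lightSpeed hk
  have hall : ∀ i ∈ M.IOb, M.LightSpeed i c := fun i hi => by
    obtain ⟨d, hd⟩ := h₀.exists_lightSpeed hi
    rwa [SpecRel.Frame.LightSpeed.unique h₀ hc hk hi hkc hd]
  exact ⟨fun h => (h.preservesForm h₀ hall).axSymDist h₀,
    fun h => (h.preservesForm h₀ hall).axSymTime h₀ hkc.1.ne'⟩
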